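/- **Definitions.** Let $n\ge 1$. For $m\ge1$ let $\mathbb T_m(\mathbb R)$ be the set of lower triangular real $m\times m$ matrices all of whose diagonal entries are equal, let $\mathbb S$ be the set of real matrices $\begin{bmatrix}\alpha&\beta\\-\beta&\alpha\end{bmatrix}$, and let $\mathbb B_m(\mathbb R)$ be the set of real $2m\times 2m$ matrices that are lower block triangular with $2\times2$ blocks, all blocks lying in $\mathbb S$ and all diagonal blocks being equal. For $r,s\ge 0$ and a sequence of positive integers $\eta=(n_1,\dots,n_r;m_1,\dots,m_s)$ with $(n_1+\dots+n_r)+2(m_1+\dots+m_s)=n$, let $$\mathcal K_{\eta,r,s}(\mathbb R)=\mathbb T_{n_1}(\mathbb R)\oplus\dots\oplus\mathbb T_{n_r}(\mathbb R)\oplus\mathbb B_{m_1}(\mathbb R)\oplus\dots\oplus\mathbb B_{m_s}(\mathbb R)\subset M_n(\mathbb R)$$ (block diagonal matrices), $\mathcal K^*_{\eta,r,s}(\mathbb R)=\mathcal K_{\eta,r,s}(\mathbb R)\cap \mathrm{GL}(n,\mathbb R)$, and let $u_0\in\mathbb R^n$ be the vector whose entry is $1$ at the first position of each of the $r+s$ diagonal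 blocks and $0$ elsewhere. A subset of $\mathbb R^n$ is *locally dense* if its closure has nonempty interior. For a subgroup $G$ of $\mathrm{GL}(n,\mathbb R)$ and $v\in\mathbb R^n$, the orbit is $G(v)=\{Av: A\in G\}$. **Theorem.** Let $G$ be an abelian subgroup of $\mathrm{GL}(n,\mathbb R)$. There exist $r,s,\eta$ as above and $P\in \mathrm{GL}(n,\mathbb R)$ with $P^{-1}GP\subset\mathcal K^*_{\eta,r,s}(\mathbb R)$. Moreover, for every such choice of $r,s,\eta,P$, put $v_0=Pu_0$, $\mathrm g=\exp^{-1}(G)\cap P\,\mathcal K_{\eta,r,s}(\mathbb R)\,P^{-1}$ (where $\exp$ is the matrix exponential on $M_n(\mathbb R)$) and $\mathrm g_{v_0}=\{Bv_0: B\in \mathrm g\}$. Then $\mathrm g_{v_0}$ is an additive subgroup of $\mathbb R^n$, and the following are equivalent: (i) $G$ has a locally dense orbit in $\mathbb R^n$; (ii) the orbit $G(v_0)$ is locally dense in $\mathbb R^n$; (iii) $\mathrm g_{v_0}$ is dense in $\mathbb R^n$. -/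

import Mathlib

open scoped Matrix

noncomputable section

namespace AbelianGL

/-- The orbit `G(v) = {A v : A ∈ G}` of the linear action on `ℝⁿ`. -/
def orbit {n : ℕ} (G : Subgroup (GL (Fin n) ℝ)) (v : Fin n → ℝ) : Set (Fin n → ℝ) :=
  {w | ∃ A ∈ G, w = (A : Matrix (Fin n) (Fin n) ℝ) *ᵥ v}

/-- A set is locally dense if its closure has nonempty interior. -/
def LocallyDense {n : ℕ} (E : Set (Fin n → ℝ)) : Prop :=
  (interior (closure E)).Nonempty

/-- `𝕋ₘ(ℝ)`: lower triangular matrices with constant diagonal. -/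
def T (m : ℕ) : Set (Matrix (Fin m) (Fin m) ℝ) :=
  {A | (∃ μ : ℝ, ∀ i, A i i = μ) ∧ ∀ i j, i < j → A i j = 0}

/-- `𝕊`: the real matrices `[α, β; -β, α]`. -/
def S : Set (Matrix (Fin 2) (Fin 2) ℝ) :=
  {C | ∃ α β : ℝ, C = !![α, β; -β, α]}

/-- The `2 × 2` block of `A` in block row `i` and block column `j`. -/
def block {m : ℕ} (A : Matrix (Fin m × Fin 2) (Fin m × Fin 2) ℝ) (i j : Fin m) :
    Matrix (Fin 2) (Fin 2) ℝ :=
  Matrix.of fun a b => A (i, a) (j, b)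

/-- `𝔹ₘ(ℝ)`: lower block-triangular `2m × 2m` matrices with `2 × 2` blocks in `𝕊` and constant
block diagonal. The index `(i, a)` stands for position `2 i + a` (counting from `0`). -/
def B (m : ℕ) : Set (Matrix (Fin m × Fin 2) (Fin m × Fin 2) ℝ) :=
  {A | (∀ i j, block A i j ∈ S) ∧ (∃ C, ∀ i, block A i i = C) ∧ ∀ i j, i < j → block A i j = 0}

/-- The data `η = (n₁, …, n_r; m₁, …, m_s)`: positive integers, `r, s ≥ 0`, with
`(n₁ + ⋯ + n_r) + 2 (m₁ + ⋯ + m_s) = n`. -/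
structure BlockType (n : ℕ) where
  r : ℕ
  s : ℕ
  realSize : Fin r → ℕ
  complexSize : Fin s → ℕ
  realSize_pos : ∀ k, 0 < realSize k
  complexSize_pos : ∀ l, 0 < complexSize l
  sum_eq : (∑ k, realSize k) + 2 * ∑ l, complexSize l = n

namespace BlockType

variable {n : ℕ} (η : BlockType n)

theorem sum_eq' : (∑ k, η.realSize k) + ∑ l, η.complexSize l * 2 = n := by
  rw [← Finset.sum_mul, mul_comm (∑ l, η.complexSize l) 2]
  exact η.sum_eq

/-- Positions inside the blocks: first the `r` real blocks, then the `s` complex ones. -/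
abbrev Index : Type :=
  (Σ k : Fin η.r, Fin (η.realSize k)) ⊕ (Σ l : Fin η.s, Fin (η.complexSize l) × Fin 2)

/-- The identification of block positions with `{0, …, n - 1}`, in consecutive order. -/
def indexEquiv : η.Index ≃ Fin n :=
  (Equiv.sumCongr finSigmaFinEquiv
    ((Equiv.sigmaCongrRight fun _ => finProdFinEquiv).trans finSigmaFinEquiv)).trans
    (finSumFinEquiv.trans (finCongr η.sum_eq'))

/-- `𝒦_{η,r,s}(ℝ)`: the block diagonal matrices
`diag(M₁, …, M_r; M̃₁, …, M̃_s)` with `M_k ∈ 𝕋_{n_k}(ℝ)` and `M̃_l ∈ 𝔹_{m_l}(ℝ)`. -/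
def K : Set (Matrix (Fin n) (Fin n) ℝ) :=
  {A | ∃ (M : ∀ k, Matrix (Fin (η.realSize k)) (Fin (η.realSize k)) ℝ)
      (N : ∀ l, Matrix (Fin (η.complexSize l) × Fin 2) (Fin (η.complexSize l) × Fin 2) ℝ),
      (∀ k, M k ∈ T (η.realSize k)) ∧ (∀ l, N l ∈ B (η.complexSize l)) ∧
      A = Matrix.reindex η.indexEquiv η.indexEquiv
        (Matrix.fromBlocks (Matrix.blockDiagonal' M) 0 0 (Matrix.blockDiagonal' N))}

/-- `𝒦*_{η,r,s}(ℝ) = 𝒦_{η,r,s}(ℝ) ∩ GL(n, ℝ)`. -/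
def Kstar : Set (GL (Fin n) ℝ) :=
  {A | (A : Matrix (Fin n) (Fin n) ℝ) ∈ η.K}

/-- `u₀`: the vector with entry `1` at the first position of each block, `0` elsewhere. -/
def u₀ : Fin n → ℝ := fun i =>
  Sum.elim
    (fun x : Σ k : Fin η.r, Fin (η.realSize k) => if (x.2 : ℕ) = 0 then (1 : ℝ) else 0)
    (fun x : Σ l : Fin η.s, Fin (η.complexSize l) × Fin 2 =>
      if (x.2.1 : ℕ) = 0 ∧ x.2.2 = 0 then (1 : ℝ) else 0)
    (η.indexEquiv.symm i)

end BlockType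

/-- `P⁻¹ G P ⊆ 𝒦*_{η,r,s}(ℝ)`. -/
def IsNormalForm {n : ℕ} (G : Subgroup (GL (Fin n) ℝ)) (η : BlockType n) (P : GL (Fin n) ℝ) :
    Prop :=
  ∀ A ∈ G, P⁻¹ * A * P ∈ η.Kstar

/-- `v₀ = P u₀`. -/
def v₀ {n : ℕ} (η : BlockType n) (P : GL (Fin n) ℝ) : Fin n → ℝ :=
  (P : Matrix (Fin n) (Fin n) ℝ) *ᵥ η.u₀

/-- `g = exp⁻¹(G) ∩ P 𝒦_{η,r,s}(ℝ) P⁻¹`. -/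
def g {n : ℕ} (G : Subgroup (GL (Fin n) ℝ)) (η : BlockType n) (P : GL (Fin n) ℝ) :
    Set (Matrix (Fin n) (Fin n) ℝ) :=
  {X | (∃ A ∈ G, NormedSpace.exp X = (A : Matrix (Fin n) (Fin n) ℝ)) ∧
    ∃ M ∈ η.K, X = (P : Matrix (Fin n) (Fin n) ℝ) * M * ((P⁻¹ : GL (Fin n) ℝ) : Matrix _ _ ℝ)}

/-- `g_u = {X u : X ∈ g}`. -/
def gAt {n : ℕ} (G : Subgroup (GL (Fin n) ℝ)) (η : BlockType n) (P : GL (Fin n) ℝ)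
    (u : Fin n → ℝ) : Set (Fin n → ℝ) :=
  {w | ∃ X ∈ g G η P, w = X *ᵥ u}

end AbelianGL

end

/-! Normal form. The real algebra generated by `G` is commutative and finite-dimensional, so `ℝⁿ`
splits into pieces, each killed by a power of a maximal ideal `I`
(`exists_isInternal_torsionBySet`), with residue field `ℝ` or `ℂ`. On such a piece `W` every element
acts as a residue scalar plus an element of `I`, and `I` shifts the filtration by the spans of `I ^
j • W`; this gives triangular matrices (`exists_basis_triangular`). In the complex case a lifted
square root of `-1` turns `W` into a complex space (`exists_sq_add_one_mem_pow`).

Equivalence. Every element of `𝒦` is central plus nilpotent, and whatever commutes with `exp N`, `N`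
nilpotent, commutes with `N`. Hence logarithms in `𝒦` of elements of `G` commute
(`commute_of_mem_logSet`) and form an additive group. A commutative algebra of operators with cyclic
vector `w` is linearly homeomorphic to the space through `a ↦ a w` (`evalEquiv`), so density
questions move into the algebra, where `exp` is a local homeomorphism at `0`. If `G(v₀)` is locally
dense, then `G` is dense near `1`, its logarithms are dense near `0`, and a subgroup of a real
vector space that is dense near `0` is dense. Conversely, a dense group of logarithms exponentiates
to a set dense near `1`.

If some `G(v)` is locally dense, then `v` is cyclic and `v₀ = a v` with `a` in the algebra of `G`.
The first row of each block forces `a` to be invertible (`isUnit_of_mulVec_eq_v₀`), and `G(v₀) = a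
G(v)`. -/

namespace AbelianGL

open Polynomial Topology

/-! ### The exponential: nilpotent elements, and behaviour near `0` -/

section Exponential

variable {R : Type*} [NormedRing R] [NormedAlgebra ℝ R]

/-- The exponential of a nilpotent element is a polynomial in it. -/
theorem exists_exp_eq_aeval_of_pow_eq_zero {N : R} {k : ℕ} (hN : N ^ k = 0) :
    ∃ q : ℝ[X], NormedSpace.exp N = aeval N (1 + X * (1 + X * q)) := by
  -- The exponential series without its first two terms, divided by `X ^ 2`.
  refine ⟨∑ j ∈ Finset.range k, C ((((j + 2).factorial : ℕ) : ℝ)⁻¹) * X ^ j, ?_⟩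
  have hs : NormedSpace.exp N =
      ∑ j ∈ Finset.range (k + 2), ((j.factorial : ℝ)⁻¹) • N ^ j := by
    rw [NormedSpace.exp_eq_tsum ℝ]
    refine tsum_eq_sum fun j hj => ?_
    rw [pow_eq_zero_of_le (by simp at hj; omega) hN, smul_zero]
  rw [hs, Finset.sum_range_succ', Finset.sum_range_succ']
  simp only [map_add, map_mul, map_one, aeval_X, map_sum, map_pow, aeval_C, mul_add, mul_one,
    Finset.mul_sum, Nat.factorial, Nat.cast_one, inv_one, one_smul, pow_zero, zero_add, pow_one]
  rw [add_comm, add_comm (Finset.sum _ _)]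
  congr 2
  refine Finset.sum_congr rfl fun j _ => ?_
  rw [Algebra.smul_def, ← mul_assoc N, ← mul_assoc (N * N),
    ← Algebra.commutes _ (N * N), mul_assoc, ← pow_two, ← pow_add, add_comm 2 j, add_assoc]

/-- Whatever commutes with `exp N`, `N` nilpotent, commutes with `N`. -/
theorem commute_of_commute_exp_of_pow_eq_zero {N Z : R} {k : ℕ} (hN : N ^ k = 0)
    (h : Commute (NormedSpace.exp N) Z) : Commute N Z := by
  obtain ⟨q, hq⟩ := exists_exp_eq_aeval_of_pow_eq_zero hN
  set w : ℝ[X] := 1 + X * q with hw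
  have hM : Commute (aeval N (X * w)) Z := by
    have : aeval N (X * w) = NormedSpace.exp N - 1 := by
      rw [hq, map_add, map_one, add_sub_cancel_left]
    rw [this]
    exact h.sub_left (Commute.one_left Z)
  -- Descending induction on the power of `N`, starting from `N ^ k = 0`. As `w ≡ 1` modulo `X`, `X
  -- ^ j` is `(X * w) ^ j` up to a multiple of `X ^ (j + 1)`, and `N * w(N) = exp N - 1` commutes
  -- with `Z`.
  have step : ∀ i ≤ k, ∀ p : ℝ[X], Commute (aeval N (X ^ (k - i) * p)) Z := by
    intro i
    induction i with
    | zero =>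
      intro _ p
      simp [hN]
    | succ i ih =>
      intro hi p
      have ih := ih (by omega)
      obtain ⟨j, hj⟩ : ∃ j, k - i = j + 1 := ⟨k - i - 1, by omega⟩
      have hj' : k - (i + 1) = j := by omega
      rw [hj']
      rw [hj] at ih
      have hpow : Commute (aeval N (X ^ j : ℝ[X])) Z := by
        obtain ⟨t, ht⟩ : X ∣ w ^ j - 1 := by
          have h1 : w - 1 ∣ w ^ j - 1 := by simpa using sub_dvd_pow_sub_pow w 1 j
          exact (Dvd.intro q (by rw [hw]; ring)).trans h1
        have : (X ^ j : ℝ[X]) = (X * w) ^ j - X ^ (j + 1) * t := by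
          rw [mul_pow, pow_succ, mul_assoc, ← ht]; ring
        rw [this, map_sub, map_pow]
        exact (hM.pow_left j).sub_left (ih t)
      have hp : X ^ j * p = X ^ (j + 1) * p.divX + C (p.coeff 0) * X ^ j := by
        conv_lhs => rw [← divX_mul_X_add p]
        ring
      rw [hp, map_add, map_mul _ (C _), aeval_C]
      exact (ih _).add_left ((Algebra.commute_algebraMap_left _ _).mul_left hpow)
  simpa using step k le_rfl X

variable [CompleteSpace R]

/-- The exponential pulls sets that are dense near `1` back to sets that are dense near `0`. -/
theorem closure_preimage_exp_mem_nhds {S : Set R} (hS : closure S ∈ 𝓝 (1 : R)) :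
    closure (NormedSpace.exp ⁻¹' S) ∈ 𝓝 (0 : R) := by
  have hd : HasStrictFDerivAt (NormedSpace.exp : R → R)
      ((ContinuousLinearEquiv.refl ℝ R : R ≃L[ℝ] R) : R →L[ℝ] R) 0 :=
    hasStrictFDerivAt_exp_zero
  set e := hd.toOpenPartialHomeomorph (NormedSpace.exp : R → R) with he
  have hcoe : (e : R → R) = NormedSpace.exp := hd.toOpenPartialHomeomorph_coe
  have h0 : (0 : R) ∈ e.source := hd.mem_toOpenPartialHomeomorph_source
  have hc : NormedSpace.exp ⁻¹' closure S ∈ 𝓝 (0 : R) := by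
    refine hd.continuousAt.preimage_mem_nhds ?_
    rwa [NormedSpace.exp_zero]
  filter_upwards [e.open_source.mem_nhds h0, hc] with y hy hyS
  have hyt : NormedSpace.exp y ∈ e.target := hcoe ▸ e.map_source hy
  -- Openness of the target lets the approximating points of `S` be taken where the local inverse is
  -- defined.
  have h1 : NormedSpace.exp y ∈ closure (e.target ∩ S) :=
    e.open_target.inter_closure ⟨hyt, hyS⟩
  have h2 : e.symm (NormedSpace.exp y) ∈ closure (e.symm '' (e.target ∩ S)) :=
    (e.symm.continuousAt hyt).continuousWithinAt.mem_closure_image h1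
  have h3 : e.symm (NormedSpace.exp y) = y := by rw [← hcoe, e.left_inv hy]
  rw [h3] at h2
  refine closure_mono ?_ h2
  rintro _ ⟨z, ⟨hz, hzS⟩, rfl⟩
  rw [Set.mem_preimage, ← hcoe, e.right_inv hz]
  exact hzS

/-- The image of a dense set under the exponential is dense near `1`. -/
theorem closure_image_exp_mem_nhds {T : Set R} (hT : Dense T) :
    closure (NormedSpace.exp '' T) ∈ 𝓝 (1 : R) := by
  have hd : HasStrictFDerivAt (NormedSpace.exp : R → R)
      ((ContinuousLinearEquiv.refl ℝ R : R ≃L[ℝ] R) : R →L[ℝ] R) 0 :=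
    hasStrictFDerivAt_exp_zero
  have hmap := hd.map_nhds_eq_of_equiv
  rw [NormedSpace.exp_zero] at hmap
  -- By the inverse function theorem `exp` carries the neighbourhood filter of `0` onto that of `1`.
  rw [← hmap]
  let _ : NormedAlgebra ℚ R := NormedAlgebra.restrictScalars ℚ ℝ R
  refine Filter.mem_map.2 (Filter.mem_of_superset Filter.univ_mem fun y _ => ?_)
  exact image_closure_subset_closure_image NormedSpace.exp_continuous
    ⟨y, hT.closure_eq ▸ Set.mem_univ y, rfl⟩

end Exponential

theorem mul_comm_of_mem_adjoin {R : Type*} [Ring R] [Algebra ℝ R] {S : Set R}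
    (hS : ∀ a ∈ S, ∀ b ∈ S, a * b = b * a) :
    ∀ a ∈ Algebra.adjoin ℝ S, ∀ b ∈ Algebra.adjoin ℝ S, a * b = b * a := by
  intro a ha b hb
  have := Algebra.adjoin_le_centralizer_centralizer ℝ S
  exact Set.centralizer_centralizer_comm_of_comm hS _ (this ha) _ (this hb)

theorem mul_comm_of_mem_image_val {R : Type*} [Ring R] {G : Subgroup Rˣ}
    (hG : ∀ A ∈ G, ∀ B ∈ G, A * B = B * A) :
    ∀ a ∈ Units.val '' (G : Set Rˣ), ∀ b ∈ Units.val '' (G : Set Rˣ), a * b = b * a := by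
  rintro _ ⟨A, hA, rfl⟩ _ ⟨B, hB, rfl⟩
  exact congrArg Units.val (hG A hA B hB)

/-! ### The additive group of logarithms -/

section LogarithmGroup

variable {R : Type*} [NormedRing R] [NormedAlgebra ℝ R]

/-- The elements of a subalgebra whose exponential lies in the group `G`. -/
def logSet (G : Subgroup Rˣ) (𝒦 : Subalgebra ℝ R) : Set R :=
  {X | X ∈ 𝒦 ∧ ∃ A ∈ G, NormedSpace.exp X = (A : R)}

/-- Every element is the sum of a central and a nilpotent one. -/
def HasCentralNilpotentDecomposition {R : Type*} [Ring R] [Algebra ℝ R] (𝒦 : Subalgebra ℝ R) :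
    Prop :=
  ∀ X ∈ 𝒦, ∃ D N, X = D + N ∧ (∀ Y ∈ 𝒦, Commute D Y) ∧ IsNilpotent N

variable [CompleteSpace R]

theorem exp_add_of_commute_real {x y : R} (h : Commute x y) :
    NormedSpace.exp (x + y) = NormedSpace.exp x * NormedSpace.exp y := by
  let _ : NormedAlgebra ℚ R := NormedAlgebra.restrictScalars ℚ ℝ R
  exact NormedSpace.exp_add_of_commute h

/-- Since `exp N = exp (-D) * exp X`, the question reduces to the nilpotent part. -/
theorem commute_of_commute_exp {X D N Z : R} (hX : X = D + N)
    (hN : IsNilpotent N) (hDX : Commute D X) (hDZ : Commute D Z)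
    (h : Commute (NormedSpace.exp X) Z) : Commute X Z := by
  obtain ⟨k, hk⟩ := hN
  have hN : NormedSpace.exp N = NormedSpace.exp (-D) * NormedSpace.exp X := by
    rw [← exp_add_of_commute_real hDX.neg_left, hX, neg_add_cancel_left]
  have : Commute N Z := by
    refine commute_of_commute_exp_of_pow_eq_zero hk ?_
    rw [hN]
    exact (Commute.exp_left hDZ.neg_left).mul_left h
  rw [hX]
  exact hDZ.add_left this

/-- The exponentials are removed one at a time: `exp X` commutes with `exp Y`, hence `X` does, and
then `Y` commutes with `X`. This is where restricting logarithms to `𝒦` matters. -/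
theorem commute_of_mem_logSet {G : Subgroup Rˣ} (hG : ∀ A ∈ G, ∀ B ∈ G, A * B = B * A)
    {𝒦 : Subalgebra ℝ R} (hdec : HasCentralNilpotentDecomposition 𝒦)
    {X Y : R} (hX : X ∈ logSet G 𝒦) (hY : Y ∈ logSet G 𝒦) : Commute X Y := by
  obtain ⟨hXK, A, hA, hXA⟩ := hX
  obtain ⟨hYK, B, hB, hYB⟩ := hY
  obtain ⟨D, N, hX, hD, hN⟩ := hdec X hXK
  obtain ⟨D', N', hY, hD', hN'⟩ := hdec Y hYK
  have hAB : Commute (NormedSpace.exp X) (NormedSpace.exp Y) := by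
    rw [hXA, hYB]
    exact congrArg Units.val (hG A hA B hB)
  have h1 : Commute X (NormedSpace.exp Y) :=
    commute_of_commute_exp hX hN (hD X hXK) (Commute.exp_right (hD Y hYK)) hAB
  exact (commute_of_commute_exp hY hN' (hD' Y hYK) (hD' X hXK) h1.symm).symm

/-- The logarithms of an abelian group `G` in `𝒦` form an additive group. -/
def logAddSubgroup {G : Subgroup Rˣ} (hG : ∀ A ∈ G, ∀ B ∈ G, A * B = B * A)
    {𝒦 : Subalgebra ℝ R} (hdec : HasCentralNilpotentDecomposition 𝒦) : AddSubgroup R where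
  carrier := logSet G 𝒦
  zero_mem' := ⟨zero_mem _, 1, one_mem _, by simp⟩
  add_mem' := by
    intro X Y hX hY
    have hXY := commute_of_mem_logSet hG hdec hX hY
    obtain ⟨hXK, A, hA, hXA⟩ := hX
    obtain ⟨hYK, B, hB, hYB⟩ := hY
    refine ⟨add_mem hXK hYK, A * B, mul_mem hA hB, ?_⟩
    rw [exp_add_of_commute_real hXY, hXA, hYB, Units.val_mul]
  neg_mem' := by
    rintro X ⟨hXK, A, hA, hXA⟩
    refine ⟨neg_mem hXK, A⁻¹, inv_mem hA, ?_⟩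
    exact Units.eq_inv_of_mul_eq_one_left (by
      rw [← hXA, ← exp_add_of_commute_real (Commute.refl X).neg_right, add_neg_cancel,
        NormedSpace.exp_zero])

end LogarithmGroup

/-! ### Orbits and cyclic vectors of commutative operator algebras -/

section Orbits

variable {R V : Type*} [NormedRing R] [NormedAlgebra ℝ R]
  [NormedAddCommGroup V] [NormedSpace ℝ V]

/-- Evaluation of a subalgebra of operators at a vector. -/
def evalAt (ρ : R →ₐ[ℝ] Module.End ℝ V) (𝒜 : Subalgebra ℝ R) (w : V) : 𝒜 →ₗ[ℝ] V where
  toFun a := ρ a w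
  map_add' _ _ := by simp
  map_smul' _ _ := by simp

/-- If `a w = 0`, then `a (b w) = b (a w) = 0`, and the vectors `b w` fill the space. -/
theorem evalAt_injective {ρ : R →ₐ[ℝ] Module.End ℝ V} (hρ : Function.Injective ρ)
    {𝒜 : Subalgebra ℝ R} {w : V} (hcomm : ∀ a ∈ 𝒜, ∀ b ∈ 𝒜, a * b = b * a)
    (hsurj : Function.Surjective (evalAt ρ 𝒜 w)) : Function.Injective (evalAt ρ 𝒜 w) := by
  refine (injective_iff_map_eq_zero _).2 fun a ha => Subtype.ext (hρ ?_)
  ext x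
  obtain ⟨b, rfl⟩ := hsurj x
  change ρ a (ρ b w) = _
  rw [← Module.End.mul_apply, ← map_mul, hcomm a a.2 b b.2, map_mul, Module.End.mul_apply]
  change ρ b (evalAt ρ 𝒜 w a) = _
  simp [ha]

variable [FiniteDimensional ℝ R]

/-- Evaluation of a commutative algebra of operators at a cyclic vector, as a linear
homeomorphism. -/
noncomputable def evalEquiv {ρ : R →ₐ[ℝ] Module.End ℝ V} (hρ : Function.Injective ρ)
    {𝒜 : Subalgebra ℝ R} {w : V} (hcomm : ∀ a ∈ 𝒜, ∀ b ∈ 𝒜, a * b = b * a)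
    (hsurj : Function.Surjective (evalAt ρ 𝒜 w)) : 𝒜 ≃L[ℝ] V :=
  (LinearEquiv.ofBijective (evalAt ρ 𝒜 w)
    ⟨evalAt_injective hρ hcomm hsurj, hsurj⟩).toContinuousLinearEquiv

theorem evalEquiv_apply {ρ : R →ₐ[ℝ] Module.End ℝ V} (hρ : Function.Injective ρ)
    {𝒜 : Subalgebra ℝ R} {w : V} (hcomm : ∀ a ∈ 𝒜, ∀ b ∈ 𝒜, a * b = b * a)
    (hsurj : Function.Surjective (evalAt ρ 𝒜 w)) (a : 𝒜) :
    evalEquiv hρ hcomm hsurj a = ρ a w := rfl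

/-- A vector at which the evaluations of a set are dense in some open set is cyclic. -/
theorem evalAt_surjective_of_nonempty_interior {ρ : R →ₐ[ℝ] Module.End ℝ V} {S : Set R} {w : V}
    (h : (interior (closure ((fun a => ρ a w) '' S))).Nonempty) :
    Function.Surjective (evalAt ρ (Algebra.adjoin ℝ S) w) := by
  rw [← LinearMap.range_eq_top]
  refine Submodule.eq_top_of_nonempty_interior' _ (h.mono (interior_mono ?_))
  refine closure_minimal ?_ (Submodule.closed_of_finiteDimensional _)
  rintro _ ⟨a, ha, rfl⟩
  exact ⟨⟨a, Algebra.subset_adjoin ha⟩, rfl⟩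

theorem image_evalEquiv {ρ : R →ₐ[ℝ] Module.End ℝ V} (hρ : Function.Injective ρ) {S : Set R}
    {w : V} (hcomm : ∀ a ∈ Algebra.adjoin ℝ S, ∀ b ∈ Algebra.adjoin ℝ S, a * b = b * a)
    (hsurj : Function.Surjective (evalAt ρ (Algebra.adjoin ℝ S) w)) :
    (fun a => ρ a w) '' S = evalEquiv hρ hcomm hsurj '' (Subtype.val ⁻¹' S) := by
  ext x
  constructor
  · rintro ⟨a, ha, rfl⟩
    exact ⟨⟨a, Algebra.subset_adjoin ha⟩, ha, rfl⟩
  · rintro ⟨a, ha, rfl⟩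
    exact ⟨a, ha, rfl⟩

theorem completeSpace_subalgebra (𝒜 : Subalgebra ℝ R) :
    CompleteSpace 𝒜 :=
  FiniteDimensional.complete ℝ 𝒜

theorem coe_exp {𝒜 : Subalgebra ℝ R} (a : 𝒜) :
    ((NormedSpace.exp a : 𝒜) : R) = NormedSpace.exp (a : R) := by
  let _ : NormedAlgebra ℚ 𝒜 := NormedAlgebra.restrictScalars ℚ ℝ 𝒜
  let _ : NormedAlgebra ℚ R := NormedAlgebra.restrictScalars ℚ ℝ R
  have := completeSpace_subalgebra 𝒜
  exact NormedSpace.map_exp 𝒜.val continuous_subtype_val a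

variable {ρ : R →ₐ[ℝ] Module.End ℝ V} {G : Subgroup Rˣ} {𝒦 : Subalgebra ℝ R} {w : V}

/-- If some orbit is locally dense, then so is the orbit of `w`, provided that only invertible
elements of `𝒦` take the value `w`. -/
theorem nonempty_interior_closure_orbit_of_exists [FiniteDimensional ℝ V]
    (hG : ∀ A ∈ G, ∀ B ∈ G, A * B = B * A)
    (hGK : Units.val '' (G : Set Rˣ) ⊆ 𝒦)
    (hunit : ∀ a ∈ 𝒦, ∀ v, ρ a v = w → IsUnit a)
    {v : V} (hv : (interior (closure ((fun a => ρ a v) '' (Units.val '' (G : Set Rˣ))))).Nonempty) :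
    (interior (closure ((fun a => ρ a w) '' (Units.val '' (G : Set Rˣ))))).Nonempty := by
  -- The vector `v` is cyclic, so some `a` in the algebra of `G` sends it to `w`. It is invertible
  -- and commutes with `G`, so it carries the orbit of `v` homeomorphically onto that of `w`.
  obtain ⟨⟨a, ha⟩, haw⟩ := evalAt_surjective_of_nonempty_interior hv w
  replace haw : ρ a v = w := haw
  obtain ⟨u, rfl⟩ := hunit a (Algebra.adjoin_le hGK ha) v haw
  have hcomm := mul_comm_of_mem_adjoin (mul_comm_of_mem_image_val hG)
  let e : V ≃L[ℝ] V := LinearEquiv.toContinuousLinearEquiv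
    (LinearEquiv.ofLinearMap (ρ u) (ρ (u⁻¹ : Rˣ))
      (by rw [← Module.End.mul_eq_comp, ← map_mul]; simp [Module.End.one_eq_id])
      (by rw [← Module.End.mul_eq_comp, ← map_mul]; simp [Module.End.one_eq_id]))
  have himage : (fun a => ρ a w) '' (Units.val '' (G : Set Rˣ)) =
      e '' ((fun a => ρ a v) '' (Units.val '' (G : Set Rˣ))) := by
    rw [Set.image_image (⇑e)]
    refine Set.image_congr fun b hb => ?_
    change ρ b w = ρ u (ρ b v)
    rw [← haw, ← Module.End.mul_apply, ← Module.End.mul_apply, ← map_mul, ← map_mul,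
      hcomm _ (Algebra.subset_adjoin hb) _ ha]
  have hinternal := e.toHomeomorph.image_interior
    (closure ((fun a => ρ a v) '' (Units.val '' (G : Set Rˣ))))
  rw [himage, ← e.image_closure]
  exact hinternal ▸ hv.image e

/-- If the orbit of `w` is locally dense, then the logarithms of `G` evaluate to a dense set. -/
theorem dense_image_logSet_of_nonempty_interior
    (hG : ∀ A ∈ G, ∀ B ∈ G, A * B = B * A) (hρ : Function.Injective ρ)
    (hGK : Units.val '' (G : Set Rˣ) ⊆ 𝒦) (hdec : HasCentralNilpotentDecomposition 𝒦)
    (hw : (interior (closure ((fun a => ρ a w) '' (Units.val '' (G : Set Rˣ))))).Nonempty) :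
    Dense ((fun a => ρ a w) '' logSet G 𝒦) := by
  have hsurj := evalAt_surjective_of_nonempty_interior hw
  have hcomm := mul_comm_of_mem_adjoin (mul_comm_of_mem_image_val hG)
  set 𝒜 := Algebra.adjoin ℝ (Units.val '' (G : Set Rˣ)) with h𝒜
  let e := evalEquiv hρ hcomm hsurj
  have := completeSpace_subalgebra 𝒜
  have : CompleteSpace R := FiniteDimensional.complete ℝ R
  set S : Set 𝒜 := Subtype.val ⁻¹' (Units.val '' (G : Set Rˣ)) with hS
  have hinternal : (interior (closure S)).Nonempty := by
    rw [image_evalEquiv hρ hcomm hsurj] at hw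
    have h1 : (interior (e '' closure S)).Nonempty := by rwa [e.image_closure]
    have h2 : e '' interior (closure S) = interior (e '' closure S) :=
      e.toHomeomorph.image_interior (closure S)
    rw [← h2] at h1
    exact Set.image_nonempty.1 h1
  -- The interior of the closure contains some `A` in `G`; multiplication by `A⁻¹` preserves `G` and
  -- moves `A` to `1`.
  have hone : closure S ∈ 𝓝 (1 : 𝒜) := by
    obtain ⟨x, hx⟩ := hinternal
    obtain ⟨a, haU, A, hA, ha⟩ :=
      mem_closure_iff.1 (interior_subset hx) _ isOpen_interior hx
    have hAinv : ((A⁻¹ : Rˣ) : R) ∈ 𝒜 := Algebra.subset_adjoin ⟨_, inv_mem hA, rfl⟩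
    have hmem : (fun b : 𝒜 => a * b) ⁻¹' interior (closure S) ∈ 𝓝 (1 : 𝒜) := by
      refine (continuous_const.mul continuous_id).continuousAt.preimage_mem_nhds ?_
      simpa using isOpen_interior.mem_nhds haU
    filter_upwards [hmem] with b hb
    have hb' : b = ⟨_, hAinv⟩ * (a * b) := by
      refine Subtype.ext ?_
      change (b : R) = _ * ((a : R) * b)
      rw [← ha, ← mul_assoc, ← Units.val_mul, inv_mul_cancel, Units.val_one, one_mul]
    rw [hb']
    refine map_mem_closure (f := fun c : 𝒜 => (⟨_, hAinv⟩ : 𝒜) * c)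
      (continuous_const.mul continuous_id) (interior_subset hb) ?_
    rintro c ⟨B, hB, hc⟩
    exact ⟨A⁻¹ * B, mul_mem (inv_mem hA) hB, by rw [Units.val_mul, hc]; rfl⟩
  have hzero := closure_preimage_exp_mem_nhds hone
  let H : AddSubgroup V :=
    (logAddSubgroup hG hdec).map ((LinearMap.applyₗ w).comp ρ.toLinearMap).toAddMonoidHom
  have hH : (H : Set V) = (fun a => ρ a w) '' logSet G 𝒦 := rfl
  have hH0 : (H.topologicalClosure : Set V) ∈ 𝓝 (0 : V) := by
    have h1 : e '' closure (NormedSpace.exp ⁻¹' S) ∈ 𝓝 (e 0) :=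
      (e.toHomeomorph.isOpenMap).image_mem_nhds hzero
    rw [map_zero, e.image_closure] at h1
    refine Filter.mem_of_superset h1 (closure_mono ?_)
    rintro _ ⟨a, ⟨A, hA, ha⟩, rfl⟩
    rw [hH]
    refine ⟨a, ⟨Algebra.adjoin_le hGK a.2, A, hA, ?_⟩, rfl⟩
    rw [← coe_exp, ha]
  -- A subgroup that is a neighbourhood of `0` is open; being closed too, it is everything by
  -- connectedness.
  have hopen : IsOpen (H.topologicalClosure : Set V) :=
    AddSubgroup.isOpen_of_mem_nhds _ hH0
  have huniv := IsClopen.eq_univ ⟨H.isClosed_topologicalClosure, hopen⟩ ⟨0, zero_mem _⟩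
  rw [← hH]
  exact dense_iff_closure_eq.2 huniv

/-- If the logarithms of `G` evaluate to a dense set at `w`, the orbit of `w` is locally dense. -/
theorem nonempty_interior_closure_orbit_of_dense
    (hG : ∀ A ∈ G, ∀ B ∈ G, A * B = B * A) (hρ : Function.Injective ρ)
    (hdec : HasCentralNilpotentDecomposition 𝒦) (hw : Dense ((fun a => ρ a w) '' logSet G 𝒦)) :
    (interior (closure ((fun a => ρ a w) '' (Units.val '' (G : Set Rˣ))))).Nonempty := by
  have : CompleteSpace R := FiniteDimensional.complete ℝ R
  -- The algebra is generated here by the logarithms instead of `G`, so that density of their values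
  -- makes `w` cyclic.
  have hcomm := mul_comm_of_mem_adjoin (S := logSet G 𝒦)
    fun X hX Y hY => commute_of_mem_logSet hG hdec hX hY
  have hsurj : Function.Surjective (evalAt ρ (Algebra.adjoin ℝ (logSet G 𝒦)) w) := by
    refine evalAt_surjective_of_nonempty_interior ?_
    rw [hw.closure_eq, interior_univ]
    exact Set.univ_nonempty
  set 𝒞 := Algebra.adjoin ℝ (logSet G 𝒦) with h𝒞
  let e := evalEquiv hρ hcomm hsurj
  have := completeSpace_subalgebra 𝒞
  set T : Set 𝒞 := Subtype.val ⁻¹' logSet G 𝒦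
  have hT : Dense T := by
    rw [image_evalEquiv hρ hcomm hsurj] at hw
    exact (e.toHomeomorph.isInducing.dense_iff.2 fun x => hw (e x))
  have h1 : e '' closure (NormedSpace.exp '' T) ∈ 𝓝 (e 1) :=
    (e.toHomeomorph.isOpenMap).image_mem_nhds (closure_image_exp_mem_nhds hT)
  rw [e.image_closure] at h1
  refine ⟨e 1, mem_interior_iff_mem_nhds.2 (Filter.mem_of_superset h1 (closure_mono ?_))⟩
  rintro _ ⟨_, ⟨c, ⟨_, A, hA, hc⟩, rfl⟩, rfl⟩
  exact ⟨A, ⟨A, hA, rfl⟩, by rw [evalEquiv_apply, coe_exp, hc]⟩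

end Orbits

/-! ### Triangular matrices over a ring -/

theorem pow_eq_zero_of_strictlyLower {R : Type*} [Ring R] {m : ℕ}
    {N : Matrix (Fin m) (Fin m) R}
    (hN : ∀ i j, i ≤ j → N i j = 0) : N ^ m = 0 := by
  -- Each factor pushes the support at least one diagonal further down.
  have key : ∀ (k : ℕ) (i j : Fin m), (i : ℕ) < j + k → (N ^ k) i j = 0 := by
    intro k
    induction k with
    | zero => intro i j hij; rw [pow_zero, Matrix.one_apply_ne (by omega)]
    | succ k ih =>
      intro i j hij
      rw [pow_succ', Matrix.mul_apply]
      refine Finset.sum_eq_zero fun l _ => ?_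
      rcases le_or_gt i l with h | h
      · rw [hN i l h, zero_mul]
      · rw [ih l j (by omega), mul_zero]
  ext i j
  exact key m i j (by omega)

section Triangular

variable {R : Type*} [Ring R] [Algebra ℝ R]

/-- Lower triangular matrices with entries in a subalgebra and constant diagonal. -/
def triangular (S : Subalgebra ℝ R) (m : ℕ) : Subalgebra ℝ (Matrix (Fin m) (Fin m) R) where
  carrier := {A | (∀ i j, A i j ∈ S) ∧ (∃ c, ∀ i, A i i = c) ∧ ∀ i j, i < j → A i j = 0}
  mul_mem' := by
    rintro A A' ⟨hS, ⟨c, hc⟩, h0⟩ ⟨hS', ⟨c', hc'⟩, h0'⟩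
    refine ⟨fun i j => ?_, ⟨c * c', fun i => ?_⟩,
      fun i j hij => ?_⟩
    · rw [Matrix.mul_apply]
      exact sum_mem fun k _ => mul_mem (hS i k) (hS' k j)
    · rw [Matrix.mul_apply, Finset.sum_eq_single i, hc, hc']
      · intro k _ hk
        rcases lt_or_gt_of_ne hk with h | h
        · rw [h0' _ _ h, mul_zero]
        · rw [h0 _ _ h, zero_mul]
      · simp
    · rw [Matrix.mul_apply]
      refine Finset.sum_eq_zero fun k _ => ?_
      rcases lt_or_ge i k with h | h
      · simp [h0 _ _ h]
      · simp [h0' _ _ (h.trans_lt hij)]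
  add_mem' := by
    rintro A A' ⟨hS, ⟨c, hc⟩, h0⟩ ⟨hS', ⟨c', hc'⟩, h0'⟩
    exact ⟨fun i j => add_mem (hS i j) (hS' i j), ⟨c + c', fun i => by simp [hc, hc']⟩,
      fun i j hij => by simp [h0 _ _ hij, h0' _ _ hij]⟩
  algebraMap_mem' r := by
    refine ⟨fun i j => ?_, ⟨algebraMap ℝ R r, fun i => ?_⟩, fun i j hij => ?_⟩
    · rw [Matrix.algebraMap_matrix_apply]
      split_ifs
      · exact S.algebraMap_mem r
      · exact S.zero_mem
    · simp [Matrix.algebraMap_matrix_apply]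
    · simp [Matrix.algebraMap_matrix_apply, hij.ne]

/-- `D` is the scalar matrix of the common diagonal entry; it is central because that entry lies in
the commutative `S`. The remainder is strictly lower triangular. -/
theorem exists_decomposition_of_mem_triangular {S : Subalgebra ℝ R}
    (hS : ∀ a ∈ S, ∀ b ∈ S, a * b = b * a) {m : ℕ} (hm : 0 < m)
    {A : Matrix (Fin m) (Fin m) R} (hA : A ∈ triangular S m) :
    ∃ D N, A = D + N ∧ (∀ A' ∈ triangular S m, Commute D A') ∧ N ^ m = 0 ∧
      (IsUnit (A ⟨0, hm⟩ ⟨0, hm⟩) → IsUnit D) := by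
  obtain ⟨hAS, ⟨c, hc⟩, h0⟩ := hA
  refine ⟨Matrix.scalar _ c, A - Matrix.scalar _ c, by simp, ?_,
    pow_eq_zero_of_strictlyLower fun i j hij => ?_, fun h => ?_⟩
  · rintro A' ⟨hS', -, -⟩
    have hcS : c ∈ S := hc ⟨0, hm⟩ ▸ hAS _ _
    ext i j
    simp [hS c hcS _ (hS' i j)]
  · rcases hij.lt_or_eq with h | rfl
    · simp [h0 _ _ h, h.ne]
    · simp [hc]
  · rw [hc] at h
    exact h.map (Matrix.scalar (Fin m))

end Triangular

/-! ### The algebras `𝕊`, `𝕋` and `𝔹` -/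

section Blocks

/-- `𝕊` as a subalgebra. -/
def subalgebraS : Subalgebra ℝ (Matrix (Fin 2) (Fin 2) ℝ) where
  carrier := S
  mul_mem' := by
    rintro _ _ ⟨α, β, rfl⟩ ⟨α', β', rfl⟩
    refine ⟨α * α' - β * β', α * β' + β * α', ?_⟩
    ext i j
    fin_cases i <;> fin_cases j <;> simp [Matrix.mul_apply, Fin.sum_univ_two] <;> ring
  add_mem' := by
    rintro _ _ ⟨α, β, rfl⟩ ⟨α', β', rfl⟩
    refine ⟨α + α', β + β', ?_⟩
    ext i j
    fin_cases i <;> fin_cases j <;> simp [add_comm]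
  algebraMap_mem' r := by
    refine ⟨r, 0, ?_⟩
    ext i j
    fin_cases i <;> fin_cases j <;> simp [Matrix.algebraMap_matrix_apply]

theorem mul_comm_of_mem_S : ∀ a ∈ subalgebraS, ∀ b ∈ subalgebraS, a * b = b * a := by
  rintro _ ⟨α, β, rfl⟩ _ ⟨α', β', rfl⟩
  ext i j
  fin_cases i <;> fin_cases j <;> simp [Matrix.mul_apply, Fin.sum_univ_two] <;> ring

/-- The determinant is `α² + β²`; `𝕊` is a copy of `ℂ`. -/
theorem isUnit_of_mem_S {C : Matrix (Fin 2) (Fin 2) ℝ} (hC : C ∈ S) (h : C ≠ 0) : IsUnit C := by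
  obtain ⟨α, β, rfl⟩ := hC
  rw [Matrix.isUnit_iff_isUnit_det, Matrix.det_fin_two_of, isUnit_iff_ne_zero]
  intro h0
  have hα : α = 0 := by nlinarith [sq_nonneg α, sq_nonneg β]
  have hβ : β = 0 := by nlinarith [sq_nonneg α, sq_nonneg β]
  refine h ?_
  ext i j
  fin_cases i <;> fin_cases j <;> simp [hα, hβ]

/-- `𝕋ₘ(ℝ)` as a subalgebra. -/
def subalgebraT (m : ℕ) : Subalgebra ℝ (Matrix (Fin m) (Fin m) ℝ) := triangular ⊤ m

theorem mem_subalgebraT {m : ℕ} {A : Matrix (Fin m) (Fin m) ℝ} : A ∈ subalgebraT m ↔ A ∈ T m :=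
  ⟨fun h => h.2, fun h => ⟨fun _ _ => Algebra.mem_top, h⟩⟩

/-- `𝔹ₘ(ℝ)` as a subalgebra. -/
def subalgebraB (m : ℕ) : Subalgebra ℝ (Matrix (Fin m × Fin 2) (Fin m × Fin 2) ℝ) :=
  (triangular subalgebraS m).comap (Matrix.compAlgEquiv (Fin m) (Fin 2) ℝ ℝ).symm.toAlgHom

theorem mem_subalgebraB {m : ℕ} {A : Matrix (Fin m × Fin 2) (Fin m × Fin 2) ℝ} :
    A ∈ subalgebraB m ↔ A ∈ B m :=
  Iff.rfl

theorem exists_decomposition_of_mem_T {m : ℕ} {A : Matrix (Fin m) (Fin m) ℝ} (hA : A ∈ T m)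
    (hm : 0 < m) :
    ∃ D N, A = D + N ∧ (∀ A' ∈ T m, Commute D A') ∧ N ^ m = 0 ∧
      (A ⟨0, hm⟩ ⟨0, hm⟩ ≠ 0 → IsUnit D) := by
  obtain ⟨D, N, h, hD, hN, hu⟩ := exists_decomposition_of_mem_triangular
    (fun a _ b _ => mul_comm a b) hm (mem_subalgebraT.2 hA)
  exact ⟨D, N, h, fun A' hA' => hD A' (mem_subalgebraT.2 hA'), hN,
    fun h => hu (isUnit_iff_ne_zero.2 h)⟩

theorem exists_decomposition_of_mem_B {m : ℕ} {A : Matrix (Fin m × Fin 2) (Fin m × Fin 2) ℝ}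
    (hA : A ∈ B m) (hm : 0 < m) :
    ∃ D N, A = D + N ∧ (∀ A' ∈ B m, Commute D A') ∧ N ^ m = 0 ∧
      (block A ⟨0, hm⟩ ⟨0, hm⟩ ≠ 0 → IsUnit D) := by
  let f := Matrix.compAlgEquiv (Fin m) (Fin 2) ℝ ℝ
  obtain ⟨D, N, h, hD, hN, hu⟩ := exists_decomposition_of_mem_triangular
    mul_comm_of_mem_S hm (mem_subalgebraB.2 hA)
  refine ⟨f D, f N, ?_, fun A' hA' => ?_, ?_, fun h => ?_⟩
  · rw [← map_add, ← h]
    exact (f.apply_symm_apply A).symm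
  · have := (hD _ (mem_subalgebraB.2 hA')).map f
    exact (f.apply_symm_apply A') ▸ this
  · rw [← map_pow, hN, map_zero]
  · exact (hu (isUnit_of_mem_S (hA.1 _ _) h)).map f

end Blocks

/-! ### The block diagonal algebra `𝒦` -/

namespace BlockType

variable {n : ℕ} (η : BlockType n)

/-- Tuples of diagonal blocks. -/
abbrev Blocks : Type :=
  (∀ k, Matrix (Fin (η.realSize k)) (Fin (η.realSize k)) ℝ) ×
    (∀ l, Matrix (Fin (η.complexSize l) × Fin 2) (Fin (η.complexSize l) × Fin 2) ℝ)

/-- The block diagonal matrix with given diagonal blocks. -/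
def assemble : η.Blocks →ₐ[ℝ] Matrix (Fin n) (Fin n) ℝ :=
  (Matrix.reindexAlgEquiv ℝ ℝ η.indexEquiv).toAlgHom.comp
    { toFun := fun p =>
        Matrix.fromBlocks (Matrix.blockDiagonal' p.1) 0 0 (Matrix.blockDiagonal' p.2)
      map_one' := by simp
      map_mul' := fun p q => by
        change Matrix.fromBlocks (Matrix.blockDiagonal' fun k => p.1 k * q.1 k) 0 0
          (Matrix.blockDiagonal' fun l => p.2 l * q.2 l) = _
        simp [Matrix.fromBlocks_multiply, Matrix.blockDiagonal'_mul]
      map_zero' := by simp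
      map_add' := fun p q => by simp [Matrix.fromBlocks_add]
      commutes' := fun r => by
        simp only [Algebra.algebraMap_eq_smul_one, Prod.smul_fst, Prod.smul_snd,
          Matrix.blockDiagonal'_smul, Prod.fst_one, Prod.snd_one, Matrix.blockDiagonal'_one]
        rw [← Matrix.fromBlocks_one, Matrix.fromBlocks_smul, smul_zero, smul_zero] }

theorem assemble_apply (p : η.Blocks) : η.assemble p = Matrix.reindex η.indexEquiv η.indexEquiv
    (Matrix.fromBlocks (Matrix.blockDiagonal' p.1) 0 0 (Matrix.blockDiagonal' p.2)) := rfl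

theorem assemble_mulVec_inl (p : η.Blocks) (v : Fin n → ℝ) (k : Fin η.r)
    (i : Fin (η.realSize k)) :
    (η.assemble p *ᵥ v) (η.indexEquiv (.inl ⟨k, i⟩)) =
      (p.1 k *ᵥ fun j => v (η.indexEquiv (.inl ⟨k, j⟩))) i := by
  rw [assemble_apply, Matrix.mulVec, dotProduct, ← η.indexEquiv.sum_comp, Fintype.sum_sum_type,
    Fintype.sum_sigma, Fintype.sum_eq_single k]
  · simp [Matrix.mulVec, dotProduct]
  · intro k' hk'
    refine Finset.sum_eq_zero fun j _ => ?_
    simp [Matrix.blockDiagonal'_apply_ne _ _ _ hk'.symm]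

theorem assemble_mulVec_inr (p : η.Blocks) (v : Fin n → ℝ) (l : Fin η.s)
    (i : Fin (η.complexSize l) × Fin 2) :
    (η.assemble p *ᵥ v) (η.indexEquiv (.inr ⟨l, i⟩)) =
      (p.2 l *ᵥ fun j => v (η.indexEquiv (.inr ⟨l, j⟩))) i := by
  rw [assemble_apply, Matrix.mulVec, dotProduct, ← η.indexEquiv.sum_comp, Fintype.sum_sum_type,
    add_comm, Fintype.sum_sigma, Fintype.sum_eq_single l]
  · simp [Matrix.mulVec, dotProduct]
  · intro l' hl'
    refine Finset.sum_eq_zero fun j _ => ?_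
    simp [Matrix.blockDiagonal'_apply_ne _ _ _ hl'.symm]

/-- Tuples of diagonal blocks in `𝕋` and `𝔹`. -/
def blockSubalgebra : Subalgebra ℝ η.Blocks where
  carrier := {p | (∀ k, p.1 k ∈ T (η.realSize k)) ∧ ∀ l, p.2 l ∈ B (η.complexSize l)}
  mul_mem' hp hq := ⟨fun k => mem_subalgebraT.1 (mul_mem (mem_subalgebraT.2 (hp.1 k))
      (mem_subalgebraT.2 (hq.1 k))),
    fun l => mem_subalgebraB.1 (mul_mem (mem_subalgebraB.2 (hp.2 l)) (mem_subalgebraB.2 (hq.2 l)))⟩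
  add_mem' hp hq := ⟨fun k => mem_subalgebraT.1 (add_mem (mem_subalgebraT.2 (hp.1 k))
      (mem_subalgebraT.2 (hq.1 k))),
    fun l => mem_subalgebraB.1 (add_mem (mem_subalgebraB.2 (hp.2 l)) (mem_subalgebraB.2 (hq.2 l)))⟩
  algebraMap_mem' c := ⟨fun _ => mem_subalgebraT.1 ((subalgebraT _).algebraMap_mem c),
    fun _ => mem_subalgebraB.1 ((subalgebraB _).algebraMap_mem c)⟩

/-- `𝒦_{η,r,s}(ℝ)` as a subalgebra. -/
def subalgebraK : Subalgebra ℝ (Matrix (Fin n) (Fin n) ℝ) := η.blockSubalgebra.map η.assemble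

theorem mem_subalgebraK {A : Matrix (Fin n) (Fin n) ℝ} : A ∈ η.subalgebraK ↔ A ∈ η.K := by
  constructor
  · rintro ⟨p, hp, rfl⟩
    exact ⟨p.1, p.2, hp.1, hp.2, rfl⟩
  · rintro ⟨M, N, hM, hN, rfl⟩
    exact ⟨(M, N), ⟨hM, hN⟩, rfl⟩

theorem exists_decomposition_of_mem_blockSubalgebra {p : η.Blocks}
    (hp : p ∈ η.blockSubalgebra) :
    ∃ d q, p = d + q ∧ (∀ p' ∈ η.blockSubalgebra, Commute d p') ∧ IsNilpotent q ∧
      ((∀ k, p.1 k ⟨0, η.realSize_pos k⟩ ⟨0, η.realSize_pos k⟩ ≠ 0) →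
        (∀ l, block (p.2 l) ⟨0, η.complexSize_pos l⟩ ⟨0, η.complexSize_pos l⟩ ≠ 0) →
        IsUnit d) := by
  choose D N h hD hN hu using fun k =>
    exists_decomposition_of_mem_T (hp.1 k) (η.realSize_pos k)
  choose D' N' h' hD' hN' hu' using fun l =>
    exists_decomposition_of_mem_B (hp.2 l) (η.complexSize_pos l)
  refine ⟨(D, D'), (N, N'), Prod.ext (funext h) (funext h'), fun p' hp' => ?_,
    ⟨(∑ k, η.realSize k) + ∑ l, η.complexSize l, ?_⟩, fun h1 h2 => ?_⟩
  · exact Prod.ext (funext fun k => hD k _ (hp'.1 k)) (funext fun l => hD' l _ (hp'.2 l))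
  · refine Prod.ext (funext fun k => ?_) (funext fun l => ?_)
    · refine pow_eq_zero_of_le (le_add_right ?_) (hN k)
      exact Finset.single_le_sum (f := η.realSize) (fun _ _ => Nat.zero_le _) (Finset.mem_univ k)
    · refine pow_eq_zero_of_le (le_add_left ?_) (hN' l)
      exact Finset.single_le_sum (f := η.complexSize) (fun _ _ => Nat.zero_le _)
        (Finset.mem_univ l)
  · exact Prod.isUnit_iff.2 ⟨Pi.isUnit_iff.2 fun k => hu k (h1 k),
      Pi.isUnit_iff.2 fun l => hu' l (h2 l)⟩

theorem hasCentralNilpotentDecomposition_subalgebraK :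
    HasCentralNilpotentDecomposition η.subalgebraK := by
  rintro _ ⟨p, hp, rfl⟩
  obtain ⟨d, q, rfl, hd, hq, -⟩ := η.exists_decomposition_of_mem_blockSubalgebra hp
  refine ⟨η.assemble d, η.assemble q, map_add _ _ _, ?_, hq.map _⟩
  rintro _ ⟨p', hp', rfl⟩
  exact (hd p' hp').map _

/-- Only invertible elements of `𝒦` take the value `u₀`. -/
theorem isUnit_of_mulVec_eq_u₀ {A : Matrix (Fin n) (Fin n) ℝ} (hA : A ∈ η.subalgebraK)
    {v : Fin n → ℝ} (hv : A *ᵥ v = η.u₀) : IsUnit A := by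
  obtain ⟨p, hp, rfl⟩ := hA
  obtain ⟨d, q, h, hd, hq, hu⟩ := η.exists_decomposition_of_mem_blockSubalgebra hp
  have hdu : IsUnit d := by
    -- If a diagonal block entry vanished, triangularity would make the first row of that block
    -- zero, whereas `u₀` has a `1` there.
    refine hu (fun k h0 => ?_) (fun l h0 => ?_)
    · have h1 := congrFun hv (η.indexEquiv (.inl ⟨k, ⟨0, η.realSize_pos k⟩⟩))
      rw [RingHom.coe_coe, assemble_mulVec_inl, Matrix.mulVec, dotProduct,
        Finset.sum_eq_zero] at h1
      · simp [u₀] at h1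
      · intro j _
        rcases (Fin.mk_le_of_le_val (Nat.zero_le j) : (⟨0, η.realSize_pos k⟩ : Fin _) ≤ j).eq_or_lt
          with hj | hj
        · rw [← hj, h0, zero_mul]
        · rw [(hp.1 k).2 _ _ hj, zero_mul]
    · have h1 := congrFun hv (η.indexEquiv (.inr ⟨l, (⟨0, η.complexSize_pos l⟩, 0)⟩))
      rw [RingHom.coe_coe, assemble_mulVec_inr, Matrix.mulVec, dotProduct,
        Finset.sum_eq_zero] at h1
      · simp [u₀] at h1
      · rintro ⟨j, b⟩ _
        have hz : block (p.2 l) ⟨0, η.complexSize_pos l⟩ j = 0 := by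
          rcases (Fin.mk_le_of_le_val (Nat.zero_le j) :
            (⟨0, η.complexSize_pos l⟩ : Fin _) ≤ j).eq_or_lt with hj | hj
          · rw [← hj, h0]
          · exact (hp.2 l).2.2 _ _ hj
        have hzb : p.2 l (⟨0, η.complexSize_pos l⟩, 0) (j, b) = 0 := congrFun (congrFun hz 0) b
        rw [hzb, zero_mul]
  have hpu : IsUnit p := by
    have hdq : Commute q d := by
      have hpd := hd p hp
      rw [h] at hpd
      have : q = (d + q) - d := by rw [add_sub_cancel_left]
      rw [this]
      exact (hpd.symm.sub_left (Commute.refl d))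
    rw [h]
    exact hq.isUnit_add_left_of_commute hdu hdq
  exact hpu.map η.assemble

end BlockType

/-! ### Triangular bases for commutative algebras -/

/-- Operators that shift a finite filtration are strictly lower triangular in some basis. -/
theorem exists_basis_strictlyLower {F W ι : Type*} [Field F] [AddCommGroup W] [Module F W]
    [FiniteDimensional F W] (f : ι → W → W) (flag : ℕ → Submodule F W) (h0 : flag 0 = ⊤) {k : ℕ}
    (hk : flag k = ⊥) (hf : ∀ a j, ∀ x ∈ flag j, f a x ∈ flag (j + 1)) :
    ∃ e : Module.Basis (Fin (Module.finrank F W)) F W,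
      ∀ a j, f a (e j) ∈ Submodule.span F (e '' {i | j < i}) := by
  have key : ∀ d ≤ Module.finrank F W, ∃ e : Fin d → W, LinearIndependent F e ∧
      ∀ a j, f a (e j) ∈ Submodule.span F (e '' {i | j < i}) := by
    intro d
    induction d with
    | zero => exact fun _ => ⟨fun i => i.elim0, linearIndependent_empty_type, fun _ j => j.elim0⟩
    | succ d ih =>
      intro hd
      obtain ⟨e, hli, he⟩ := ih (by omega)
      set U := Submodule.span F (Set.range e) with hU
      have hUtop : ¬ flag 0 ≤ U := by
        intro h
        rw [h0, top_le_iff] at h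
        have := finrank_span_eq_card hli
        rw [← hU, h, finrank_top, Fintype.card_fin] at this
        omega
      -- At the last level of the flag not yet inside `U`, any new vector is sent into `U` by every
      -- operator, so it may be put in front of the basis.
      obtain ⟨j, hj, hj'⟩ : ∃ j, ¬ flag j ≤ U ∧ flag (j + 1) ≤ U := by
        by_contra! hcon
        have : ∀ j, ¬ flag j ≤ U := fun j => by
          induction j with
          | zero => exact hUtop
          | succ j ihj => exact hcon j ihj
        exact this k (by rw [hk]; exact bot_le)
      obtain ⟨x, hx, hxU⟩ := SetLike.not_le_iff_exists.1 hj
      refine ⟨Fin.cons x e, linearIndependent_finCons.2 ⟨hli, hxU⟩, fun a i => ?_⟩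
      refine Fin.cases ?_ (fun i => ?_) i
      · refine Submodule.span_mono ?_ (hj' (hf a j x hx))
        rintro _ ⟨l, rfl⟩
        exact ⟨l.succ, Fin.succ_pos l, by simp⟩
      · rw [Fin.cons_succ]
        refine Submodule.span_mono ?_ (he a i)
        rintro _ ⟨l, hl, rfl⟩
        exact ⟨l.succ, Fin.succ_lt_succ_iff.2 hl, by simp⟩
  obtain ⟨e, hli, he⟩ := key _ le_rfl
  refine ⟨basisOfLinearIndependentOfCardEqFinrank' e hli (by simp), fun a j => ?_⟩
  simpa using he a j

/-- If every element of `A` acts on `W` as a scalar plus an element of an ideal some power of which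
kills `W`, then `A` acts by lower triangular matrices with constant diagonal. -/
theorem exists_basis_triangular {A F W : Type*} [CommRing A] [Field F] [AddCommGroup W]
    [Module F W] [Module A W] [SMulCommClass F A W] [FiniteDimensional F W] (I : Ideal A) {k : ℕ}
    (hk : ∀ y ∈ I ^ k, ∀ x : W, y • x = 0)
    (hI : ∀ a : A, ∃ c : F, ∃ y ∈ I, ∀ x : W, a • x = c • x + y • x) :
    ∃ e : Module.Basis (Fin (Module.finrank F W)) F W, ∀ a : A, ∃ Z : Matrix _ _ F,
      (∃ c, ∀ i, Z i i = c) ∧ (∀ i j, i < j → Z i j = 0) ∧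
      ∀ j, a • e j = ∑ i, Z i j • e i := by
  let flag : ℕ → Submodule F W := fun j => Submodule.span F {z | ∃ y ∈ I ^ j, ∃ x : W, z = y • x}
  obtain ⟨e, he⟩ := exists_basis_strictlyLower (F := F) (fun (a : I) (x : W) => (a : A) • x) flag
    (by
      rw [eq_top_iff]
      exact fun x _ => Submodule.subset_span ⟨1, by simp, x, by simp⟩)
    (k := k)
    (by
      rw [Submodule.span_eq_bot]
      rintro _ ⟨y, hy, x, rfl⟩
      exact hk y hy x)
    (by
      intro a j x hx
      induction hx using Submodule.span_induction with
      | mem x hx =>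
        obtain ⟨y, hy, x, rfl⟩ := hx
        refine Submodule.subset_span ⟨a * y, ?_, x, smul_smul _ _ _⟩
        rw [pow_succ']
        exact Ideal.mul_mem_mul a.2 hy
      | zero => simp
      | add x y _ _ hx hy => rw [smul_add]; exact add_mem hx hy
      | smul c x _ hx => rw [← smul_comm]; exact Submodule.smul_mem _ _ hx)
  refine ⟨e, fun a => ⟨Matrix.of fun i j => e.repr (a • e j) i, ?_, ?_, fun j => ?_⟩⟩
  · obtain ⟨c, y, hy, hx⟩ := hI a
    refine ⟨c, fun i => ?_⟩
    have := he ⟨y, hy⟩ i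
    rw [Module.Basis.mem_span_image] at this
    have h0 : e.repr (y • e i) i = 0 := by
      by_contra h
      exact lt_irrefl i (this (Finsupp.mem_support_iff.2 h))
    simp [hx, h0]
  · intro i j hij
    obtain ⟨c, y, hy, hx⟩ := hI a
    have := he ⟨y, hy⟩ j
    rw [Module.Basis.mem_span_image] at this
    have h0 : e.repr (y • e j) i = 0 := by
      by_contra h
      exact lt_asymm hij (this (Finsupp.mem_support_iff.2 h))
    simp [hx, h0, hij.ne']
  · exact (e.sum_repr (a • e j)).symm

/-- `ℂ`-linear triangular action in terms of the real basis attached to a complex one. -/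
theorem exists_basis_mem_B {A W : Type*} [CommRing A] [AddCommGroup W]
    [Module ℝ W] [Module ℂ W] [IsScalarTower ℝ ℂ W] [Module A W] [SMulCommClass ℂ A W] {m : ℕ}
    (e : Module.Basis (Fin m) ℂ W)
    (he : ∀ a : A, ∃ Z : Matrix (Fin m) (Fin m) ℂ, (∃ c, ∀ i, Z i i = c) ∧
      (∀ i j, i < j → Z i j = 0) ∧ ∀ j, a • e j = ∑ i, Z i j • e i) :
    ∃ b : Module.Basis (Fin m × Fin 2) ℝ W, ∀ a : A, ∃ N ∈ B m,
      ∀ j, a • b j = ∑ i, N i j • b i := by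
  refine ⟨Complex.basisOneI.smulTower' e, fun a => ?_⟩
  obtain ⟨Z, ⟨c, hc⟩, h0, hZ⟩ := he a
  -- Multiplication by `z` in the basis `1, i` of `ℂ` has `β = -z.im`; the double negation matches
  -- the shape required by `S`.
  refine ⟨Matrix.of fun i j => !![(Z i.1 j.1).re, -(Z i.1 j.1).im;
    -(-(Z i.1 j.1).im), (Z i.1 j.1).re] i.2 j.2,
    ⟨fun i j => ?_, ⟨!![c.re, -c.im; -(-c.im), c.re], fun i => ?_⟩, fun i j hij => ?_⟩,
    fun ⟨j, b⟩ => ?_⟩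
  · exact ⟨(Z i j).re, -(Z i j).im, rfl⟩
  · change !![(Z i i).re, -(Z i i).im; -(-(Z i i).im), (Z i i).re] = _
    rw [hc]
  · change !![(Z i j).re, -(Z i j).im; -(-(Z i j).im), (Z i j).re] = _
    rw [h0 i j hij]
    ext a b
    fin_cases a <;> fin_cases b <;> simp
  · rw [Fintype.sum_prod_type, Module.Basis.smulTower'_apply, ← smul_comm, hZ, Finset.smul_sum]
    refine Finset.sum_congr rfl fun i _ => ?_
    simp only [Module.Basis.smulTower'_apply, Fin.sum_univ_two, Matrix.of_apply, smul_smul,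
      ← smul_assoc, ← add_smul]
    congr 1
    fin_cases b <;> apply Complex.ext <;> simp

/-- A square root of `-1` modulo a maximal ideal with residue field `ℂ` lifts to a square root of
`-1` modulo any power of the ideal. -/
theorem exists_sq_add_one_mem_pow {A : Type*} [CommRing A] [Algebra ℝ A] (χ : A →ₐ[ℝ] ℂ)
    (hχ : Function.Surjective χ) {k : ℕ} (hk : k ≠ 0) :
    ∃ J : A, J * J + 1 ∈ RingHom.ker χ ^ k ∧ χ J = Complex.I := by
  obtain ⟨a, ha⟩ := hχ Complex.I
  set p := RingHom.ker χ ^ k with hp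
  have hnil : ∀ y : A, χ y = 0 → IsNilpotent (Ideal.Quotient.mk p y) := fun y hy =>
    ⟨k, by rw [← map_pow]; exact Ideal.Quotient.eq_zero_iff_mem.2 (Ideal.pow_mem_pow hy k)⟩
  have h1 : IsNilpotent (Ideal.Quotient.mk p (a * a + 1)) := hnil _ (by simp [ha])
  have h2 : IsUnit (Ideal.Quotient.mk p a) := by
    have : IsUnit (Ideal.Quotient.mk p (a * a)) := by
      have h3 := h1.isUnit_sub_one
      rwa [← map_one (Ideal.Quotient.mk p), ← map_sub, add_sub_cancel_right] at h3
    rw [map_mul] at this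
    exact isUnit_of_mul_isUnit_left this
  have h4 : IsUnit (2 : A ⧸ p) := by
    have := (isUnit_iff_ne_zero.2 (two_ne_zero (α := ℝ))).map (algebraMap ℝ (A ⧸ p))
    rwa [map_ofNat] at this
  -- Newton's method for `X ^ 2 + 1`: its value at `a` is nilpotent and its derivative `2 a` is a
  -- unit modulo `p`.
  obtain ⟨r, ⟨hr, hr'⟩, -⟩ := existsUnique_nilpotent_sub_and_aeval_eq_zero
    (x := Ideal.Quotient.mk p a) (P := (X ^ 2 + 1 : ℝ[X]))
    (by simpa [pow_two] using h1) (by simpa [derivative_X_pow, one_add_one_eq_two, map_ofNat] using h4.mul h2)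
  obtain ⟨J, rfl⟩ := Ideal.Quotient.mk_surjective r
  refine ⟨J, ?_, ?_⟩
  · rw [← Ideal.Quotient.eq_zero_iff_mem]
    simpa [pow_two] using hr'
  · obtain ⟨N, hN⟩ := hr
    rw [← map_sub, ← map_pow, Ideal.Quotient.eq_zero_iff_mem] at hN
    have : χ ((a - J) ^ N) = 0 := Ideal.pow_le_self hk hN
    rw [map_pow, map_sub, ha] at this
    exact (sub_eq_zero.1 (eq_zero_of_pow_eq_zero this)).symm

/-- A module killed by a power of a maximal ideal has a basis of real or of complex type. -/
theorem exists_basis_of_pow_maximal {A W : Type*} [CommRing A] [Algebra ℝ A] [Module.Finite ℝ A]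
    [AddCommGroup W] [Module ℝ W] [Module A W] [IsScalarTower ℝ A W] [FiniteDimensional ℝ W]
    [Nontrivial W] (I : Ideal A) [I.IsMaximal] {k : ℕ} (hk : ∀ y ∈ I ^ k, ∀ x : W, y • x = 0) :
    (∃ d, 0 < d ∧ ∃ b : Module.Basis (Fin d) ℝ W, ∀ a : A, ∃ M ∈ T d,
      ∀ j, a • b j = ∑ i, M i j • b i) ∨
    (∃ d, 0 < d ∧ ∃ b : Module.Basis (Fin d × Fin 2) ℝ W, ∀ a : A, ∃ N ∈ B d,
      ∀ j, a • b j = ∑ i, N i j • b i) := by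
  let _ := Ideal.Quotient.field I
  rcases Real.nonempty_algEquiv_or (A ⧸ I) with ⟨⟨φ⟩⟩ | ⟨⟨φ⟩⟩
  · left
    obtain ⟨b, hb⟩ := exists_basis_triangular (F := ℝ) (W := W) I hk (fun a => by
      refine ⟨φ (Ideal.Quotient.mk I a), a - algebraMap ℝ A (φ (Ideal.Quotient.mk I a)), ?_,
        fun x => ?_⟩
      · rw [← Ideal.Quotient.eq_zero_iff_mem, ← φ.map_eq_zero_iff, map_sub, map_sub, sub_eq_zero]
        exact (φ.commutes _).symm
      · rw [sub_smul, algebraMap_smul, add_sub_cancel])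
    refine ⟨_, Module.finrank_pos, b, fun a => ?_⟩
    obtain ⟨Z, h1, h2, h3⟩ := hb a
    exact ⟨Z, ⟨h1, h2⟩, h3⟩
  · right
    let χ : A →ₐ[ℝ] ℂ := φ.toAlgHom.comp (Ideal.Quotient.mkₐ ℝ I)
    have hχ : Function.Surjective χ := φ.surjective.comp (Ideal.Quotient.mkₐ_surjective ℝ I)
    have hker : RingHom.ker χ = I := by
      ext a
      rw [RingHom.mem_ker, ← Ideal.Quotient.eq_zero_iff_mem, ← φ.map_eq_zero_iff]
      rfl
    have hk0 : k ≠ 0 := by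
      rintro rfl
      obtain ⟨x, hx⟩ := exists_ne (0 : W)
      exact hx (by simpa using hk 1 (by simp) x)
    obtain ⟨J, hJ, hJI⟩ := exists_sq_add_one_mem_pow χ hχ hk0
    rw [hker] at hJ
    -- `J * J + 1` kills `W`, so `J` acts as a complex structure; since `A` is commutative, it acts
    -- `ℂ`-linearly.
    let ψ : ℂ →ₐ[ℝ] Module.End ℝ W := Complex.liftAux (Algebra.lsmul ℝ ℝ W J) (by
      ext x
      have := hk _ hJ x
      rw [add_smul, one_smul, mul_smul] at this
      simpa using eq_neg_of_add_eq_zero_left this)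
    let _ : Module ℂ W := Module.compHom W ψ.toRingHom
    have hsmul : ∀ (z : ℂ) (x : W), z • x = z.re • x + z.im • (J • x) := fun z x => by
      change ψ z x = _
      simp [ψ, Complex.liftAux_apply]
    have : IsScalarTower ℝ ℂ W := ⟨fun c z x => by simp [hsmul, mul_smul]⟩
    have : SMulCommClass ℝ A W := ⟨fun c a x => by
      rw [← algebraMap_smul A c x, ← algebraMap_smul A c (a • x), smul_smul, smul_smul, mul_comm]⟩
    have : SMulCommClass ℂ A W := ⟨fun z a x => by
      simp only [hsmul, smul_add, smul_comm a z.re, smul_comm a z.im, smul_smul J, smul_smul a,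
        mul_comm J a]⟩
    have : FiniteDimensional ℂ W := Module.Finite.of_restrictScalars_finite ℝ ℂ W
    obtain ⟨e, he⟩ := exists_basis_triangular (F := ℂ) (W := W) I hk (fun a => by
      refine ⟨χ a, a - (algebraMap ℝ A (χ a).re + algebraMap ℝ A (χ a).im * J), ?_, fun x => ?_⟩
      · rw [← hker, RingHom.mem_ker, map_sub, map_add, map_mul, hJI, AlgHom.commutes,
          AlgHom.commutes, sub_eq_zero]
        exact (Complex.re_add_im _).symm
      · rw [hsmul, sub_smul, add_smul, mul_smul, algebraMap_smul, algebraMap_smul, add_sub_cancel])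
    exact ⟨_, Module.finrank_pos, exists_basis_mem_B e he⟩

/-- A finite-dimensional module over a finite-dimensional commutative real algebra is the direct
sum of submodules killed by powers of maximal ideals. -/
theorem exists_isInternal_torsionBySet {A V : Type*} [CommRing A] [Algebra ℝ A]
    [Module.Finite ℝ A] [AddCommGroup V] [Module A V] :
    ∃ k : ℕ, iSupIndep (fun m : MaximalSpectrum A =>
        Submodule.torsionBySet A V ((m.asIdeal ^ k : Ideal A) : Set A)) ∧
      ⨆ m : MaximalSpectrum A, Submodule.torsionBySet A V ((m.asIdeal ^ k : Ideal A) : Set A) =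
        ⊤ := by
  classical
  have : IsArtinianRing A := IsArtinianRing.of_finite ℝ A
  have := Fintype.ofFinite (MaximalSpectrum A)
  obtain ⟨k, hk⟩ := IsArtinianRing.isNilpotent_nilradical (R := A)
  have hcop : Pairwise fun m m' : MaximalSpectrum A => IsCoprime m.asIdeal m'.asIdeal :=
    fun m m' h => Ideal.isCoprime_of_isMaximal fun h' => h (MaximalSpectrum.ext h')
  have hp : ((Finset.univ : Finset (MaximalSpectrum A)) : Set (MaximalSpectrum A)).Pairwise
      fun m m' => m.asIdeal ^ k ⊔ m'.asIdeal ^ k = ⊤ := fun m _ m' _ h =>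
    Ideal.isCoprime_iff_sup_eq.1 (hcop h).pow
  -- By coprimality the intersection of the powers is the `k`-th power of the intersection of all
  -- maximal ideals, which is the nilradical.
  have hbot : (⨅ m ∈ (Finset.univ : Finset (MaximalSpectrum A)), m.asIdeal ^ k) = ⊥ := by
    rw [← Ideal.prod_eq_iInf_of_pairwise_isCoprime, Finset.prod_pow,
      Ideal.prod_eq_iInf_of_pairwise_isCoprime]
    · simpa [IsArtinianRing.nilradical_eq_iInf] using hk
    · exact fun m _ m' _ h => hcop h
    · exact fun m _ m' _ h => (hcop h).pow
  refine ⟨k, ?_, ?_⟩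
  · have := Submodule.supIndep_torsionBySet_ideal (M := V) hp
    exact (iSupIndep_iff_supIndep_univ).2 this
  · have := Submodule.iSup_torsionBySet_ideal_eq_torsionBySet_iInf (M := V) hp
    rw [hbot] at this
    simp only [Finset.mem_univ, iSup_pos] at this
    rw [this, eq_top_iff]
    intro x _
    simp

theorem iSupIndep_restrictScalars {A V ι : Type*} [CommRing A] [Algebra ℝ A] [AddCommGroup V]
    [Module ℝ V] [Module A V] [IsScalarTower ℝ A V] {U : ι → Submodule A V} (hU : iSupIndep U) :
    iSupIndep fun i => (U i).restrictScalars ℝ := by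
  intro i
  have := congrArg (Submodule.restrictScalarsLatticeHom ℝ A V) (hU i).eq_bot
  simp only [map_inf, map_bot, map_iSup] at this
  exact disjoint_iff.2 this

/-- The union of bases of the summands of a direct sum indexed by a sum type. -/
theorem exists_basis_of_iSupIndep_sum {V κ ν : Type*} [AddCommGroup V] [Module ℝ V]
    {U : κ ⊕ ν → Submodule ℝ V} (hind : iSupIndep U) (htop : iSup U = ⊤)
    {β : κ → Type} {γ : ν → Type} (b : ∀ k, Module.Basis (β k) ℝ (U (.inl k)))
    (c : ∀ l, Module.Basis (γ l) ℝ (U (.inr l))) :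
    ∃ e : Module.Basis ((Σ k, β k) ⊕ (Σ l, γ l)) ℝ V,
      (∀ k j, e (.inl ⟨k, j⟩) = b k j) ∧ ∀ l j, e (.inr ⟨l, j⟩) = c l j := by
  classical
  have hinternal := DirectSum.isInternal_submodule_of_iSupIndep_of_iSup_eq_top hind htop
  let α : κ ⊕ ν → Type := Sum.elim β γ
  let v : ∀ i, Module.Basis (α i) ℝ (U i) := fun i => match i with
    | .inl k => b k
    | .inr l => c l
  refine ⟨(hinternal.collectedBasis v).reindex (Equiv.sumSigmaDistrib α), fun k j => ?_, fun l j => ?_⟩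
  · exact (Module.Basis.reindex_apply _ _ _).trans
      (congrFun (hinternal.collectedBasis_coe v) ⟨.inl k, j⟩)
  · exact (Module.Basis.reindex_apply _ _ _).trans
      (congrFun (hinternal.collectedBasis_coe v) ⟨.inr l, j⟩)

/-- A finite-dimensional commutative real algebra acts by matrices with diagonal blocks in `𝕋` and
`𝔹` with respect to a suitable basis. -/
theorem exists_basis_blocks (A V : Type*) [CommRing A] [Algebra ℝ A] [Module.Finite ℝ A]
    [AddCommGroup V] [Module ℝ V] [Module A V] [IsScalarTower ℝ A V] [FiniteDimensional ℝ V] :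
    ∃ (r s : ℕ) (d : Fin r → ℕ) (d' : Fin s → ℕ)
      (e : Module.Basis ((Σ k, Fin (d k)) ⊕ (Σ l, Fin (d' l) × Fin 2)) ℝ V),
      (∀ k, 0 < d k) ∧ (∀ l, 0 < d' l) ∧
      ∀ a : A, ∃ (M : ∀ k, Matrix (Fin (d k)) (Fin (d k)) ℝ)
        (N : ∀ l, Matrix (Fin (d' l) × Fin 2) (Fin (d' l) × Fin 2) ℝ),
        (∀ k, M k ∈ T (d k)) ∧ (∀ l, N l ∈ B (d' l)) ∧
        (∀ k j, a • e (.inl ⟨k, j⟩) = ∑ i, M k i j • e (.inl ⟨k, i⟩)) ∧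
        ∀ l j, a • e (.inr ⟨l, j⟩) = ∑ i, N l i j • e (.inr ⟨l, i⟩) := by
  classical
  obtain ⟨q, hind, htop⟩ := exists_isInternal_torsionBySet (A := A) (V := V)
  set W : MaximalSpectrum A → Submodule A V := fun m =>
    Submodule.torsionBySet A V ((m.asIdeal ^ q : Ideal A) : Set A) with hW
  have : IsArtinianRing A := IsArtinianRing.of_finite ℝ A
  -- Zero summands are dropped, because block sizes must be positive.
  let ι := {m : MaximalSpectrum A // W m ≠ ⊥}
  have := Fintype.ofFinite ι
  obtain ⟨hind, htop⟩ := (DirectSum.isInternal_submodule_iff_iSupIndep_and_iSup_eq_top _).1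
    (DirectSum.isInternal_ne_bot_iff.2
      (DirectSum.isInternal_submodule_of_iSupIndep_of_iSup_eq_top hind htop))
  let isReal : ι → Prop := fun m => ∃ d, 0 < d ∧ ∃ b : Module.Basis (Fin d) ℝ (W m.1),
    ∀ a : A, ∃ M ∈ T d, ∀ j, a • b j = ∑ i, M i j • b i
  have hcomplex : ∀ m : ι, ¬ isReal m → ∃ d, 0 < d ∧
      ∃ b : Module.Basis (Fin d × Fin 2) ℝ (W m.1),
      ∀ a : A, ∃ N ∈ B d, ∀ j, a • b j = ∑ i, N i j • b i := by
    intro m hm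
    have := (Submodule.nontrivial_iff_ne_bot).2 m.2
    have : FiniteDimensional ℝ (W m.1) :=
      inferInstanceAs (FiniteDimensional ℝ ((W m.1).restrictScalars ℝ))
    refine (exists_basis_of_pow_maximal (W := W m.1) m.1.asIdeal (k := q) ?_).resolve_left hm
    rintro y hy ⟨x, hx⟩
    exact Subtype.ext ((Submodule.mem_torsionBySet_iff _ _).1 hx ⟨y, hy⟩)
  let ε : Fin (Fintype.card {m // isReal m}) ⊕ Fin (Fintype.card {m // ¬ isReal m}) ≃ ι :=
    (Equiv.sumCongr (Fintype.equivFin _).symm (Fintype.equivFin _).symm).trans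
      (Equiv.sumCompl isReal)
  choose d hd b hb using fun k => ((Fintype.equivFin {m // isReal m}).symm k).2
  choose d' hd' b' hb' using fun l =>
    hcomplex _ ((Fintype.equivFin {m // ¬ isReal m}).symm l).2
  have hind' : iSupIndep fun i => (W (ε i).1).restrictScalars ℝ :=
    iSupIndep_restrictScalars (hind.comp ε.injective)
  have htop' : ⨆ i, (W (ε i).1).restrictScalars ℝ = ⊤ := by
    rw [← Submodule.restrictScalars_iSup, ε.iSup_comp (g := fun m => W m.1), htop,
      Submodule.restrictScalars_top]
  obtain ⟨e, he, he'⟩ := exists_basis_of_iSupIndep_sum hind' htop' b b'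
  refine ⟨_, _, d, d', e, hd, hd', fun a => ?_⟩
  choose M hM hMb using fun k => hb k a
  choose N hN hNb using fun l => hb' l a
  refine ⟨M, N, hM, hN, fun k j => ?_, fun l j => ?_⟩
  · have := congrArg Subtype.val (hMb k j)
    simp only [he]
    refine this.trans ?_
    rw [AddSubmonoidClass.coe_finsetSum]
    rfl
  · have := congrArg Subtype.val (hNb l j)
    simp only [he']
    refine this.trans ?_
    rw [AddSubmonoidClass.coe_finsetSum]
    rfl

/-! ### Existence of the normal form -/

/-- An abelian linear group is conjugate into some `𝒦*_{η,r,s}(ℝ)`. -/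
theorem exists_isNormalForm {n : ℕ} {G : Subgroup (GL (Fin n) ℝ)}
    (hG : ∀ A ∈ G, ∀ B ∈ G, A * B = B * A) :
    ∃ (η : BlockType n) (P : GL (Fin n) ℝ), IsNormalForm G η P := by
  let toEnd : Matrix (Fin n) (Fin n) ℝ ≃ₐ[ℝ] Module.End ℝ (Fin n → ℝ) := Matrix.toLinAlgEquiv'
  let 𝒜 := Algebra.adjoin ℝ {f | ∃ A ∈ G, f = toEnd (A : Matrix (Fin n) (Fin n) ℝ)}
  have hcomm : IsMulCommutative 𝒜 := Algebra.isMulCommutative_adjoin ℝ (by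
    rintro _ ⟨A, hA, rfl⟩ _ ⟨B, hB, rfl⟩
    rw [← map_mul, ← map_mul]
    exact congrArg (fun C : GL (Fin n) ℝ => toEnd (C : Matrix (Fin n) (Fin n) ℝ)) (hG A hA B hB))
  let _ : CommRing 𝒜 := { (inferInstance : Ring 𝒜) with mul_comm := hcomm.is_comm.comm }
  have : IsScalarTower ℝ 𝒜 (Fin n → ℝ) := ⟨fun _ _ _ => rfl⟩
  have : Module.Finite ℝ 𝒜 := inferInstanceAs (Module.Finite ℝ (Subalgebra.toSubmodule 𝒜))
  obtain ⟨r, s, d, d', e, hd, hd', he⟩ := exists_basis_blocks 𝒜 (Fin n → ℝ)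
  let η : BlockType n :=
    { r := r
      s := s
      realSize := d
      complexSize := d'
      realSize_pos := hd
      complexSize_pos := hd'
      sum_eq := by
        have := Module.finrank_eq_card_basis e
        simp only [Module.finrank_fin_fun, Fintype.card_sum, Fintype.card_sigma, Fintype.card_fin,
          Fintype.card_prod] at this
        rw [this, Finset.mul_sum]
        simp only [mul_comm 2] }
  let b : Module.Basis (Fin n) ℝ (Fin n → ℝ) := e.reindex η.indexEquiv
  have hb : ∀ i, b (η.indexEquiv i) = e i := fun i => by simp [b]
  let std := Pi.basisFun ℝ (Fin n)
  let P : GL (Fin n) ℝ := ⟨std.toMatrix b, b.toMatrix std, std.toMatrix_mul_toMatrix_flip b,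
    b.toMatrix_mul_toMatrix_flip std⟩
  have hP : ∀ i j, (P : Matrix (Fin n) (Fin n) ℝ) i j = b j i := fun i j => rfl
  refine ⟨η, P, fun A hA => ?_⟩
  obtain ⟨M, N, hM, hN, hMe, hNe⟩ := he ⟨_, Algebra.subset_adjoin ⟨A, hA, rfl⟩⟩
  have key : (A : Matrix (Fin n) (Fin n) ℝ) * P = P * η.assemble (M, N) := by
    have hcol : ∀ j, (A : Matrix (Fin n) (Fin n) ℝ) *ᵥ b j = ∑ i, η.assemble (M, N) i j • b i := by
      intro j
      obtain ⟨j, rfl⟩ := η.indexEquiv.surjective j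
      rw [← η.indexEquiv.sum_comp]
      simp only [hb]
      rw [Fintype.sum_sum_type, Fintype.sum_sigma, Fintype.sum_sigma]
      rcases j with ⟨k, j⟩ | ⟨l, j⟩
      · refine (hMe k j).trans ?_
        rw [Fintype.sum_eq_single k, Finset.sum_eq_zero (s := Finset.univ (α := Fin η.s)), add_zero]
        · simp only [BlockType.assemble_apply, Matrix.reindex_apply, Matrix.submatrix_apply,
            Equiv.symm_apply_apply, Matrix.fromBlocks_apply₁₁, Matrix.blockDiagonal'_apply_eq]
          rfl
        · intro l _
          simp [BlockType.assemble_apply]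
        · intro k' hk'
          simp [BlockType.assemble_apply, Matrix.blockDiagonal'_apply_ne _ _ _ hk']
      · refine (hNe l j).trans ?_
        rw [Fintype.sum_eq_single l, Finset.sum_eq_zero (s := Finset.univ (α := Fin η.r)), zero_add]
        · simp only [BlockType.assemble_apply, Matrix.reindex_apply, Matrix.submatrix_apply,
            Equiv.symm_apply_apply, Matrix.fromBlocks_apply₂₂, Matrix.blockDiagonal'_apply_eq]
          rfl
        · intro k _
          simp [BlockType.assemble_apply]
        · intro l' hl'
          simp [BlockType.assemble_apply, Matrix.blockDiagonal'_apply_ne _ _ _ hl']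
    ext i j
    have := congrFun (hcol j) i
    simp only [Finset.sum_apply, Pi.smul_apply, smul_eq_mul] at this
    rw [Matrix.mul_apply, Matrix.mul_apply]
    simp only [hP]
    refine this.trans (Finset.sum_congr rfl fun l _ => mul_comm _ _)
  refine ⟨M, N, hM, hN, ?_⟩
  rw [mul_assoc, Units.val_mul, Units.val_mul, key, ← mul_assoc, ← Units.val_mul, inv_mul_cancel,
    Units.val_one, one_mul]
  rfl

/-! ### Transport to `P 𝒦 P⁻¹` and the equivalence -/

section NormalForm

variable {n : ℕ} (η : BlockType n) (P : GL (Fin n) ℝ)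

/-- `P 𝒦_{η,r,s}(ℝ) P⁻¹` as a subalgebra. -/
def conjSubalgebraK : Subalgebra ℝ (Matrix (Fin n) (Fin n) ℝ) :=
  η.subalgebraK.map (MulSemiringAction.toAlgEquiv ℝ (Matrix (Fin n) (Fin n) ℝ)
    (ConjAct.toConjAct P)).toAlgHom

variable {η P}

theorem mem_conjSubalgebraK {X : Matrix (Fin n) (Fin n) ℝ} :
    X ∈ conjSubalgebraK η P ↔ ∃ M ∈ η.K, X = (P : Matrix (Fin n) (Fin n) ℝ) * M *
      ((P⁻¹ : GL (Fin n) ℝ) : Matrix (Fin n) (Fin n) ℝ) := by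
  constructor
  · rintro ⟨M, hM, rfl⟩
    exact ⟨M, η.mem_subalgebraK.1 hM, rfl⟩
  · rintro ⟨M, hM, rfl⟩
    exact ⟨M, η.mem_subalgebraK.2 hM, rfl⟩

theorem hasCentralNilpotentDecomposition_conjSubalgebraK :
    HasCentralNilpotentDecomposition (conjSubalgebraK η P) := by
  rintro _ ⟨M, hM, rfl⟩
  obtain ⟨D, N, rfl, hD, hN⟩ := η.hasCentralNilpotentDecomposition_subalgebraK M hM
  refine ⟨_, _, map_add _ _ _, ?_, hN.map _⟩
  rintro _ ⟨M', hM', rfl⟩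
  exact (hD M' hM').map _

/-- Conjugation by `P` reduces this to `u₀`. It supplies the invertibility needed to pass from an
arbitrary locally dense orbit to that of `v₀`. -/
theorem isUnit_of_mulVec_eq_v₀ {X : Matrix (Fin n) (Fin n) ℝ} (hX : X ∈ conjSubalgebraK η P)
    {v : Fin n → ℝ} (hv : X *ᵥ v = v₀ η P) : IsUnit X := by
  obtain ⟨M, hM, rfl⟩ := mem_conjSubalgebraK.1 hX
  have hMu : IsUnit M := by
    refine η.isUnit_of_mulVec_eq_u₀ (η.mem_subalgebraK.2 hM)
      (v := ((P⁻¹ : GL (Fin n) ℝ) : Matrix (Fin n) (Fin n) ℝ) *ᵥ v) ?_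
    have h := congrArg (fun w => ((P⁻¹ : GL (Fin n) ℝ) : Matrix (Fin n) (Fin n) ℝ) *ᵥ w) hv
    simp only [v₀, Matrix.mulVec_mulVec, ← mul_assoc] at h
    rw [← Units.val_mul, inv_mul_cancel, Units.val_one, one_mul, Matrix.one_mulVec] at h
    rw [Matrix.mulVec_mulVec, h]
  exact (P.isUnit.mul hMu).mul (P⁻¹).isUnit

theorem image_val_subset_conjSubalgebraK {G : Subgroup (GL (Fin n) ℝ)}
    (h : IsNormalForm G η P) :
    Units.val '' (G : Set (GL (Fin n) ℝ)) ⊆ (conjSubalgebraK η P : Set _) := by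
  rintro _ ⟨A, hA, rfl⟩
  refine mem_conjSubalgebraK.2 ⟨_, h A hA, ?_⟩
  rw [← Units.val_mul, ← Units.val_mul]
  congr 1
  group

open scoped Matrix.Norms.Operator in
theorem g_eq_logSet (G : Subgroup (GL (Fin n) ℝ)) :
    g G η P = logSet G (conjSubalgebraK η P) :=
  Set.ext fun _ => and_comm.trans (and_congr_left fun _ => mem_conjSubalgebraK.symm)

theorem orbit_eq_image (G : Subgroup (GL (Fin n) ℝ)) (v : Fin n → ℝ) :
    orbit G v = (fun a => (Matrix.toLinAlgEquiv' (R := ℝ) (n := Fin n)).toAlgHom a v) ''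
      (Units.val '' (G : Set (GL (Fin n) ℝ))) := by
  ext x
  constructor
  · rintro ⟨A, hA, rfl⟩
    exact ⟨_, ⟨A, hA, rfl⟩, rfl⟩
  · rintro ⟨_, ⟨A, hA, rfl⟩, rfl⟩
    exact ⟨A, hA, rfl⟩

open scoped Matrix.Norms.Operator in
theorem gAt_eq_image (G : Subgroup (GL (Fin n) ℝ)) (v : Fin n → ℝ) :
    gAt G η P v = (fun a => (Matrix.toLinAlgEquiv' (R := ℝ) (n := Fin n)).toAlgHom a v) ''
      logSet G (conjSubalgebraK η P) := by
  rw [← g_eq_logSet]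
  ext x
  constructor
  · rintro ⟨X, hX, rfl⟩
    exact ⟨X, hX, rfl⟩
  · rintro ⟨X, hX, rfl⟩
    exact ⟨X, hX, rfl⟩

open scoped Matrix.Norms.Operator in
theorem exists_addSubgroup_eq_gAt {G : Subgroup (GL (Fin n) ℝ)}
    (hG : ∀ A ∈ G, ∀ B ∈ G, A * B = B * A) (v : Fin n → ℝ) :
    ∃ H : AddSubgroup (Fin n → ℝ), (H : Set (Fin n → ℝ)) = gAt G η P v := by
  have : CompleteSpace (Matrix (Fin n) (Fin n) ℝ) := FiniteDimensional.complete ℝ _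
  refine ⟨(logAddSubgroup hG (hasCentralNilpotentDecomposition_conjSubalgebraK
    (η := η) (P := P))).map
    ((LinearMap.applyₗ v).comp
      (Matrix.toLinAlgEquiv' (R := ℝ) (n := Fin n)).toAlgHom.toLinearMap).toAddMonoidHom, ?_⟩
  rw [gAt_eq_image]
  rfl

open scoped Matrix.Norms.Operator in
theorem tfae_locallyDense {G : Subgroup (GL (Fin n) ℝ)}
    (hG : ∀ A ∈ G, ∀ B ∈ G, A * B = B * A) (h : IsNormalForm G η P) :
    List.TFAE [∃ v : Fin n → ℝ, LocallyDense (orbit G v), LocallyDense (orbit G (v₀ η P)),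
      Dense (gAt G η P (v₀ η P))] := by
  have hρ : Function.Injective (Matrix.toLinAlgEquiv' (R := ℝ) (n := Fin n)).toAlgHom :=
    (Matrix.toLinAlgEquiv' (R := ℝ) (n := Fin n)).injective
  have hGK := image_val_subset_conjSubalgebraK h
  simp only [LocallyDense, orbit_eq_image, gAt_eq_image]
  tfae_have 1 → 2 := fun ⟨v, hv⟩ =>
    nonempty_interior_closure_orbit_of_exists hG hGK
      (fun a ha v hv => isUnit_of_mulVec_eq_v₀ ha hv) hv
  tfae_have 2 → 3 := dense_image_logSet_of_nonempty_interior hG hρ hGK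
    hasCentralNilpotentDecomposition_conjSubalgebraK
  tfae_have 3 → 2 := nonempty_interior_closure_orbit_of_dense hG hρ
    hasCentralNilpotentDecomposition_conjSubalgebraK
  tfae_have 2 → 1 := fun h => ⟨_, h⟩
  tfae_finish

end NormalForm

end AbelianGL

theorem theorem1p1 (n : ℕ) (hn : 1 ≤ n) (G : Subgroup (GL (Fin n) ℝ))
    (hG : ∀ A ∈ G, ∀ B ∈ G, A * B = B * A) :
    (∃ (η : AbelianGL.BlockType n) (P : GL (Fin n) ℝ), AbelianGL.IsNormalForm G η P) ∧
    ∀ (η : AbelianGL.BlockType n) (P : GL (Fin n) ℝ), AbelianGL.IsNormalForm G η P →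
      (∃ H : AddSubgroup (Fin n → ℝ),
        (H : Set (Fin n → ℝ)) = AbelianGL.gAt G η P (AbelianGL.v₀ η P)) ∧
      List.TFAE [
        ∃ v : Fin n → ℝ, AbelianGL.LocallyDense (AbelianGL.orbit G v),
        AbelianGL.LocallyDense (AbelianGL.orbit G (AbelianGL.v₀ η P)),
        Dense (AbelianGL.gAt G η P (AbelianGL.v₀ η P))] :=
  ⟨AbelianGL.exists_isNormalForm hG, fun _ _ h =>
    ⟨AbelianGL.exists_addSubgroup_eq_gAt hG _, AbelianGL.tfae_locallyDense hG h⟩⟩
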